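/- Theorem (regret bound of the ternary policy). Let $\theta\sim\mathrm{Unif}[-1,1]$ and let $x_1,\dots,x_T,z_1,\dots,z_T$ be standard normal random variables, all of these variables being independent. Arm $1$ has payoff $r_t(1)=x_t\theta+z_t$ in round $t$, and arm $-1$ has payoff $r_t(-1)=0$. Fix $C_\epsilon>0$ and put $l_1=-1$, $u_1=1$. In round $t=1,\dots,T$, let $m_t=(l_t+u_t)/2$, $w_t=u_t-l_t$, $\epsilon_t=C_\epsilon w_t$, and proceed as follows. (i) The recommender commits to the signal function $\mu_t$ with $\mu_t(z)=1$ if $x_tm_t+z>\epsilon_t$, $\mu_t(z)=-1$ if $x_tm_t+z<-\epsilon_t$, and $\mu_t(z)=0$ otherwise, and sends the message $a_t=\mu_t(z_t)$. (ii) The user, who knows $\theta$, $x_t$, $\mu_t$ and $a_t$ but not $z_t$, computes $Z_t=\mathbb E[z_t\mid \mu_t,a_t]$, that is, the mean of the standard normal distribution conditioned on the set $\{z:\mu_t(z)=a_t\}$, and chooses $b_t=1$ if $x_t\theta+Z_t>0$ and $b_t=-1$ otherwise. (iii) If $b_tx_t>0$, then $l_{t+1}=\max\{l_t,-Z_t/x_t\}$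 and $u_{t+1}=u_t$; if $b_tx_t<0$, then $l_{t+1}=l_t$ and $u_{t+1}=\min\{u_t,-Z_t/x_t\}$; if $x_t=0$ (an event of probability zero), then $l_{t+1}=l_t$ and $u_{t+1}=u_t$. Let $\mathrm{Reg}(T)=\sum_{t=1}^T\bigl(\max\{r_t(1),r_t(-1)\}-r_t(b_t)\bigr)$. Then for every $C_\epsilon>0$ there is a constant $C_{\mathrm{ter}}>0$, depending only on $C_\epsilon$ (in particular not on $T$), such that for every $T$ the regret $\mathrm{Reg}(T)$ is integrable and $$\mathbb E[\mathrm{Reg}(T)]\le C_{\mathrm{ter}}.$$ -/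

import Mathlib

open MeasureTheory ProbabilityTheory

namespace DeviationLearning

noncomputable section

/-- The payoff `r(b)` of arm `b ∈ {-1, 1}` with state `θ`, context `x` and dynamic payoff `z`:
`r(1) = x θ + z` and `r(-1) = 0`. -/
def payoff (θ x z : ℝ) (b : ℤˣ) : ℝ := if b = 1 then x * θ + z else 0

/-- Per-round regret `r(b*) - r(b)`, where `r(b*)` is the larger of the two payoffs. -/
def regret (θ x z : ℝ) (b : ℤˣ) : ℝ :=
  max (payoff θ x z 1) (payoff θ x z (-1)) - payoff θ x z b

/-- The law of a standard normal dynamic payoff `z` given that the signal function `μ`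
has sent the message `a`. -/
def posterior {A : Type*} (μ : ℝ → A) (a : A) : Measure ℝ :=
  ProbabilityTheory.cond (gaussianReal 0 1) (μ ⁻¹' {a})

/-- `Z = 𝔼[z | μ, a]`. -/
def posteriorMean {A : Type*} (μ : ℝ → A) (a : A) : ℝ := ∫ z, z ∂posterior μ a

/-- The arm chosen by a user who knows `θ`, `x` and has posterior mean `Z` of the dynamic payoff:
arm `1` if its conditional expected payoff `x θ + Z` is positive, arm `-1` otherwise. -/
def userArm (θ x Z : ℝ) : ℤˣ := if 0 < x * θ + Z then 1 else -1

/-- The ternary signal function with parameter `ε`, when the recommender's estimate of the state is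
`m` and the context is `x`. The messages `1`, `0`, `-1` are the elements of `SignType`. -/
def ternarySignal (m x ε : ℝ) (z : ℝ) : SignType :=
  if ε < x * m + z then 1 else if x * m + z < -ε then -1 else 0

/-- The recommender's confidence interval `[l, u]`. -/
structure ConfInterval where
  l : ℝ
  u : ℝ

namespace ConfInterval

/-- The estimate `m = (l + u) / 2`. -/
def mid (I : ConfInterval) : ℝ := (I.l + I.u) / 2

/-- The width `w = u - l`. -/
def width (I : ConfInterval) : ℝ := I.u - I.l

/-- The belief update after the choice `b` of a user with context `x` and posterior mean `Z`.
Nothing is updated when `x = 0`. -/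
def update (I : ConfInterval) (x Z : ℝ) (b : ℤˣ) : ConfInterval where
  l := if 0 < ((b : ℤ) : ℝ) * x then max I.l (-Z / x) else I.l
  u := if ((b : ℤ) : ℝ) * x < 0 then min I.u (-Z / x) else I.u

end ConfInterval

/-- The signal function of the ternary policy with `ε = C w` in a round that starts with the
confidence interval `I` and has context `x`. -/
def policySignal (C : ℝ) (I : ConfInterval) (x : ℝ) : ℝ → SignType :=
  ternarySignal I.mid x (C * I.width)

/-- The user's posterior mean `Z` in such a round when the dynamic payoff is `z`, so that the
message sent is `policySignal C I x z`. -/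
def roundMean (C : ℝ) (I : ConfInterval) (x z : ℝ) : ℝ :=
  posteriorMean (policySignal C I x) (policySignal C I x z)

/-- The arm that the user chooses in such a round. -/
def roundArm (C θ : ℝ) (I : ConfInterval) (x z : ℝ) : ℤˣ :=
  userArm θ x (roundMean C I x z)

/-- The confidence interval at the beginning of each round (rounds are numbered from `0`), when the
state is `θ`, the contexts are `x 0, x 1, …` and the dynamic payoffs are `z 0, z 1, …`. -/
def confInterval (C θ : ℝ) (x z : ℕ → ℝ) : ℕ → ConfInterval
  | 0 => ⟨-1, 1⟩
  | t + 1 =>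
      (confInterval C θ x z t).update (x t) (roundMean C (confInterval C θ x z t) (x t) (z t))
        (roundArm C θ (confInterval C θ x z t) (x t) (z t))

/-- The cumulative regret of the first `T` rounds under the ternary policy with `ε_t = C w_t`. -/
def cumRegret (C θ : ℝ) (x z : ℕ → ℝ) (T : ℕ) : ℝ :=
  ∑ t ∈ Finset.range T,
    regret θ (x t) (z t) (roundArm C θ (confInterval C θ x z t) (x t) (z t))

end

end DeviationLearning

namespace DeviationLearning

/-! The width `w` of the confidence interval is a potential: one round costs expected regret `O(w ^
2)` and lowers the expected width by at least a constant times `w ^ 2`. So a constant multiple `K`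
of the width pays for the regret. Telescoping bounds the total by `K` times the initial width `2`,
whatever `T` is.

Cost (`regret_roundArm_le`): if the message is `0`, or is `±1` and is followed, regret is positive
only when `z` lies within `O(w)` of `-x m`. This has probability `O(w)` and costs `O(w)`. A
deviation from a message `±1` forces the mean excess of the Gaussian over its cutoff `c` to be at
most `|x| w / 2`. That excess is at least of order `1 / (1 + |c|)` (`mean_excess_lower_bound`), so
`w (1 + |x|) ^ 2` is bounded below. Its square can then be inserted as a factor, and Gaussian
moments absorb the powers of `|x|`.

Gain (`width_update_le_of_abs_le`): for contexts in a fixed interval above `4 C`, message `0` has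
probability at least of order `w`. The user's choice then compares `θ` with a point near the
midpoint, so a quarter of the width is lost.

Independence of the past and the current round makes these one-round bounds usable conditionally on
the past. -/

/-! ### Gaussian tails, conditional means and moments -/

theorem setIntegral_gaussianReal {s : Set ℝ} (hs : MeasurableSet s) (f : ℝ → ℝ) :
    ∫ z in s, f z ∂gaussianReal 0 1 = ∫ z in s, gaussianPDFReal 0 1 z * f z := by
  rw [← integral_indicator hs, integral_gaussianReal_eq_integral_smul one_ne_zero,
    ← integral_indicator hs]
  congr 1
  ext z
  by_cases hz : z ∈ s <;> simp [hz]

theorem integrable_id_gaussianReal : Integrable (fun z : ℝ => z) (gaussianReal 0 1) :=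
  (memLp_id_gaussianReal (μ := 0) (v := 1) 1).integrable (by simp)

theorem gaussianPDFReal_std (z : ℝ) :
    gaussianPDFReal 0 1 z = (√(2 * Real.pi))⁻¹ * Real.exp (-z ^ 2 / 2) := by
  simp [gaussianPDFReal_def]

/-- A translation estimate for Gaussian tails. -/
theorem setIntegral_le_gaussianReal_Ioi_add (c h : ℝ) :
    ∫ z in Set.Ioi c, (1 - h * z - h ^ 2 / 2) ∂gaussianReal 0 1
      ≤ (gaussianReal 0 1).real (Set.Ioi (c + h)) := by
  have e1 : (gaussianReal 0 1).real (Set.Ioi (c + h))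
      = ∫ z in Set.Ioi c, gaussianPDFReal 0 1 (z + h) := by
    have := setIntegral_gaussianReal (measurableSet_Ioi (a := c + h)) (fun _ => 1)
    simp only [integral_const, smul_eq_mul, mul_one, measureReal_restrict_apply_univ] at this
    rw [this, ← integral_indicator measurableSet_Ioi, ← integral_indicator measurableSet_Ioi,
      ← integral_add_right_eq_self _ h]
    congr 1
    ext z
    by_cases hz : c < z <;> simp [Set.indicator, hz]
  rw [e1, setIntegral_gaussianReal measurableSet_Ioi]
  have i2 : Integrable (fun z : ℝ => gaussianPDFReal 0 1 (z + h)) :=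
    (integrable_gaussianPDFReal 0 1).comp_add_right h
  have i1 : Integrable (fun z : ℝ => gaussianPDFReal 0 1 z * (1 - h * z - h ^ 2 / 2)) := by
    have h1 : Integrable (fun z : ℝ => 1 - h * z - h ^ 2 / 2) (gaussianReal 0 1) :=
      ((integrable_const _).sub (integrable_id_gaussianReal.const_mul h)).sub (integrable_const _)
    rw [gaussianReal_of_var_ne_zero _ one_ne_zero, integrable_withDensity_iff_integrable_smul'
      (measurable_gaussianPDF 0 1) (by simp [gaussianPDF_lt_top])] at h1
    simpa [toReal_gaussianPDF] using h1
  refine setIntegral_mono i1.integrableOn i2.integrableOn fun z => ?_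
  -- The shifted density has an explicit ratio to the original one; `exp u ≥ 1 + u` bounds it below.
  have : gaussianPDFReal 0 1 (z + h)
      = gaussianPDFReal 0 1 z * Real.exp (-(h * z + h ^ 2 / 2)) := by
    rw [gaussianPDFReal_std, gaussianPDFReal_std, mul_assoc, ← Real.exp_add]
    ring_nf
  simp only [this]
  refine mul_le_mul_of_nonneg_left ?_ (gaussianPDFReal_nonneg _ _ _)
  linarith [Real.add_one_le_exp (-(h * z + h ^ 2 / 2))]

theorem gaussianReal_Ioi_pos (c : ℝ) : 0 < (gaussianReal 0 1).real (Set.Ioi c) := by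
  refine ENNReal.toReal_pos (fun h => ?_) (measure_ne_top _ _)
  simpa using gaussianReal_absolutelyContinuous' 0 one_ne_zero h

/-- The mean excess of a standard normal variable over `c` is at least of order `1 / (1 + |c|)`. -/
theorem mean_excess_lower_bound (c : ℝ) :
    (c + 3 / 16 / (1 + |c|)) * (gaussianReal 0 1).real (Set.Ioi c)
      ≤ ∫ z in Set.Ioi c, z ∂gaussianReal 0 1 := by
  set γ := gaussianReal 0 1
  set q := γ.real (Set.Ioi c)
  have hq : 0 < q := gaussianReal_Ioi_pos c
  set I := ∫ z in Set.Ioi c, z ∂γ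
  -- The tail beyond `c` decays on the scale `1 / (1 + |c|)`. With this `h`, the tail beyond `c + h`
  -- keeps the fraction `1 - 1/2 - 1/8 = 3/8`, whence `3/8 * h = 3/16 / (1 + |c|)`.
  set h := 1 / (2 * (1 + |c|)) with hh
  have hc := abs_nonneg c
  have hpos : 0 < h := by positivity
  have h1 : h * (1 + |c|) = 1 / 2 := by rw [hh]; field_simp
  have hle : h ≤ 1 / 2 := by nlinarith
  have e : 3 / 16 / (1 + |c|) = 3 / 8 * h := by rw [hh]; field_simp; norm_num
  have intz : Integrable (fun z : ℝ => z) γ := integrable_id_gaussianReal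
  have A : q - h * I - h ^ 2 / 2 * q ≤ γ.real (Set.Ioi (c + h)) := by
    refine le_trans (le_of_eq ?_) (setIntegral_le_gaussianReal_Ioi_add c h)
    rw [integral_sub, integral_sub, integral_const_mul]
    · simp only [integral_const, smul_eq_mul, mul_one, measureReal_restrict_apply_univ]
      simp only [q, I, γ]; ring
    · exact integrable_const _
    · exact (intz.const_mul h).integrableOn
    · exact ((integrable_const _).sub (intz.const_mul h)).integrableOn
    · exact integrable_const _
  -- Markov's inequality for the excess `z - c`.
  have B : h * γ.real (Set.Ioi (c + h)) ≤ I - c * q := by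
    have e2 : I - c * q = ∫ z in Set.Ioi c, (z - c) ∂γ := by
      rw [integral_sub intz.integrableOn (integrable_const _)]
      simp only [integral_const, smul_eq_mul, measureReal_restrict_apply_univ]
      simp only [q, I]; ring
    have e3 : h * γ.real (Set.Ioi (c + h)) = ∫ z in Set.Ioi (c + h), h ∂γ := by
      simp [mul_comm]
    rw [e2, e3]
    refine le_trans (setIntegral_mono_on (integrable_const _)
      (intz.sub (integrable_const c)).integrableOn measurableSet_Ioi fun z hz => ?_)
      (setIntegral_mono_set (intz.sub (integrable_const c)).integrableOn ?_
        (LE.le.eventuallyLE (Set.Ioi_subset_Ioi (by linarith))))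
    · simp only [Set.mem_Ioi] at hz; simp; linarith
    · filter_upwards [ae_restrict_mem measurableSet_Ioi] with z hz
      simp only [Set.mem_Ioi] at hz; simp; linarith
  rw [e]
  -- `A` is useful only if the conditional mean is not too large; if it exceeds `c + 1`, the claim
  -- is immediate because `3/8 * h ≤ 1`.
  by_cases hI : I ≤ (c + 1) * q
  · have hI2 : h * I ≤ 1 / 2 * q := by
      rw [← h1]
      have : I ≤ (1 + |c|) * q := hI.trans (by nlinarith [le_abs_self c])
      nlinarith
    have h2 : h ^ 2 / 2 * q ≤ 1 / 8 * q := mul_le_mul_of_nonneg_right (by nlinarith) hq.le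
    have h3 : 3 / 8 * q ≤ γ.real (Set.Ioi (c + h)) := by linarith
    nlinarith [mul_le_mul_of_nonneg_left h3 hpos.le]
  · push Not at hI
    nlinarith

theorem integral_cond_gaussianReal (s : Set ℝ) :
    ∫ z, z ∂(ProbabilityTheory.cond (gaussianReal 0 1) s)
      = ((gaussianReal 0 1).real s)⁻¹ * ∫ z in s, z ∂gaussianReal 0 1 := by
  rw [ProbabilityTheory.cond, integral_smul_measure]
  simp [Measure.real]

theorem le_integral_cond_Ioi (c : ℝ) :
    c + 3 / 16 / (1 + |c|) ≤ ∫ z, z ∂(ProbabilityTheory.cond (gaussianReal 0 1) (Set.Ioi c)) := by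
  rw [integral_cond_gaussianReal, ← div_eq_inv_mul, le_div_iff₀ (gaussianReal_Ioi_pos c)]
  exact mean_excess_lower_bound c

theorem integral_cond_Iio (c : ℝ) :
    ∫ z, z ∂(ProbabilityTheory.cond (gaussianReal 0 1) (Set.Iio c))
      = -∫ z, z ∂(ProbabilityTheory.cond (gaussianReal 0 1) (Set.Ioi (-c))) := by
  have hm : (gaussianReal 0 1).map (fun x => -x) = gaussianReal 0 1 := by
    simpa using gaussianReal_map_neg (μ := 0) (v := 1)
  have e : (fun x : ℝ => -x) ⁻¹' Set.Ioi (-c) = Set.Iio c := by ext; simp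
  have h1 : (gaussianReal 0 1).real (Set.Ioi (-c)) = (gaussianReal 0 1).real (Set.Iio c) := by
    conv_lhs => rw [← hm]
    rw [map_measureReal_apply measurable_neg measurableSet_Ioi, e]
  have h2 : ∫ z in Set.Ioi (-c), z ∂gaussianReal 0 1 = ∫ z in Set.Iio c, -z ∂gaussianReal 0 1 := by
    conv_lhs => rw [← hm]
    rw [setIntegral_map measurableSet_Ioi (by fun_prop) (by fun_prop), e]
  rw [integral_cond_gaussianReal, integral_cond_gaussianReal, h1, h2, integral_neg]
  ring

theorem integral_cond_Iio_le (c : ℝ) :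
    ∫ z, z ∂(ProbabilityTheory.cond (gaussianReal 0 1) (Set.Iio c)) ≤ c - 3 / 16 / (1 + |c|) := by
  rw [integral_cond_Iio]
  have := le_integral_cond_Ioi (-c)
  rw [abs_neg] at this
  linarith

/-- A mean stays in a closed convex set carrying the law. After message `0` this places the user's
threshold close to the midpoint. -/
theorem integral_cond_Icc_mem {a b : ℝ} (hab : a < b) :
    ∫ z, z ∂(ProbabilityTheory.cond (gaussianReal 0 1) (Set.Icc a b)) ∈ Set.Icc a b := by
  have h0 : gaussianReal 0 1 (Set.Icc a b) ≠ 0 := fun h => by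
    have := gaussianReal_absolutelyContinuous' 0 one_ne_zero h
    simp at this
    linarith
  have := cond_isProbabilityMeasure h0
  refine (convex_Icc a b).integral_mem isClosed_Icc (ae_cond_mem measurableSet_Icc) ?_
  rw [ProbabilityTheory.cond]
  exact (integrable_id_gaussianReal.integrableOn).smul_measure (by simp [h0])

theorem gaussianReal_Icc_le (a b : ℝ) :
    gaussianReal 0 1 (Set.Icc a b) ≤ ENNReal.ofReal (b - a) := by
  rw [gaussianReal_apply _ one_ne_zero, ← Real.volume_Icc, ← setLIntegral_one]
  refine lintegral_mono fun z => ?_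
  rw [gaussianPDF, ← ENNReal.ofReal_one, gaussianPDFReal_std]
  refine ENNReal.ofReal_le_ofReal (mul_le_one₀ ?_ (Real.exp_pos _).le ?_)
  · refine inv_le_one_of_one_le₀ (Real.one_le_sqrt.2 ?_)
    linarith [Real.pi_gt_three]
  · refine Real.exp_le_one_iff.2 ?_
    nlinarith [sq_nonneg z]

/-- On `[-R, R]` the density is smallest at the end points. -/
theorem le_gaussianReal_Icc {a b R : ℝ} (ha : -R ≤ a) (hb : b ≤ R) :
    ENNReal.ofReal (gaussianPDFReal 0 1 R) * ENNReal.ofReal (b - a)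
      ≤ gaussianReal 0 1 (Set.Icc a b) := by
  rw [gaussianReal_apply _ one_ne_zero, ← Real.volume_Icc, ← setLIntegral_const]
  refine setLIntegral_mono (measurable_gaussianPDF 0 1) fun z hz => ?_
  rw [gaussianPDF, gaussianPDFReal_std, gaussianPDFReal_std]
  refine ENNReal.ofReal_le_ofReal (mul_le_mul_of_nonneg_left (Real.exp_le_exp.2 ?_) (by positivity))
  have : z ^ 2 ≤ R ^ 2 := sq_le_sq' (by linarith [hz.1]) (by linarith [hz.2])
  linarith

theorem lintegral_gaussianReal_one_add_abs_pow_lt_top (n : ℕ) :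
    ∫⁻ x, ENNReal.ofReal ((1 + |x|) ^ n) ∂gaussianReal 0 1 < ⊤ := by
  rcases eq_or_ne n 0 with rfl | hn
  · simp
  have h0 : MemLp (fun x : ℝ => ‖x‖) (n : ENNReal) (gaussianReal 0 1) :=
    (memLp_id_gaussianReal' (n : ENNReal) (ENNReal.natCast_ne_top n)).norm
  have h1 : MemLp (fun _ : ℝ => (1 : ℝ)) (n : ENNReal) (gaussianReal 0 1) := memLp_const 1
  have := ((h1.add h0).integrable_norm_pow hn).lintegral_lt_top
  refine lt_of_eq_of_lt (lintegral_congr fun x => ?_) this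
  change _ = ENNReal.ofReal (‖1 + |x|‖ ^ n)
  rw [Real.norm_of_nonneg (by positivity)]

/-! ### Confidence intervals and their update -/

/-- The intervals that the policy can hold when the state is `θ`. -/
structure ConfInterval.Admissible (I : ConfInterval) (θ : ℝ) : Prop where
  neg_one_le : -1 ≤ I.l
  le_one : I.u ≤ 1
  l_le : I.l ≤ θ
  le_u : θ ≤ I.u

theorem ConfInterval.Admissible.width_nonneg {I : ConfInterval} {θ : ℝ} (h : I.Admissible θ) :
    0 ≤ I.width := by
  have := h.l_le.trans h.le_u
  simp only [ConfInterval.width]; linarith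

theorem ConfInterval.Admissible.width_le_two {I : ConfInterval} {θ : ℝ} (h : I.Admissible θ) :
    I.width ≤ 2 := by
  have := h.neg_one_le; have := h.le_one
  simp only [ConfInterval.width]; linarith

theorem ConfInterval.Admissible.abs_mid_le {I : ConfInterval} {θ : ℝ} (h : I.Admissible θ) :
    |I.mid| ≤ 1 := by
  have := h.neg_one_le; have := h.le_one; have := h.l_le; have := h.le_u
  rw [abs_le]; simp only [ConfInterval.mid]
  constructor <;> linarith

theorem ConfInterval.Admissible.abs_mul_sub_mid_le {I : ConfInterval} {θ : ℝ}
    (h : I.Admissible θ) (x : ℝ) : |x * (θ - I.mid)| ≤ |x| * I.width / 2 := by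
  have h1 := h.l_le; have h2 := h.le_u
  have : |θ - I.mid| ≤ I.width / 2 := by
    rw [abs_le]; simp only [ConfInterval.mid, ConfInterval.width]
    constructor <;> linarith
  rw [abs_mul, mul_div_assoc]
  exact mul_le_mul_of_nonneg_left this (abs_nonneg x)

theorem ConfInterval.l_le_update (I : ConfInterval) (x Z : ℝ) (b : ℤˣ) :
    I.l ≤ (I.update x Z b).l := by
  simp only [ConfInterval.update]; split_ifs <;> simp

theorem ConfInterval.update_le_u (I : ConfInterval) (x Z : ℝ) (b : ℤˣ) :
    (I.update x Z b).u ≤ I.u := by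
  simp only [ConfInterval.update]; split_ifs <;> simp

theorem ConfInterval.width_update_le (I : ConfInterval) (x Z : ℝ) (b : ℤˣ) :
    (I.update x Z b).width ≤ I.width := by
  have := I.l_le_update x Z b; have := I.update_le_u x Z b
  simp only [ConfInterval.width]; linarith

/-- The choice reveals the sign of `x θ + Z`, hence the side of `-Z / x` on which `θ` lies, so the
update never cuts off `θ`. -/
theorem ConfInterval.Admissible.update {I : ConfInterval} {θ : ℝ} (h : I.Admissible θ)
    (x Z : ℝ) : (I.update x Z (userArm θ x Z)).Admissible θ := by
  refine ⟨h.neg_one_le.trans (I.l_le_update _ _ _), (I.update_le_u _ _ _).trans h.le_one, ?_, ?_⟩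
  · simp only [ConfInterval.update, userArm]
    split_ifs with h1 h2 h2
    · simp only [Units.val_one, Int.cast_one, one_mul] at h2
      exact max_le h.l_le (by rw [div_le_iff₀ h2]; linarith)
    · exact h.l_le
    · simp only [Units.val_neg, Units.val_one, Int.cast_neg, Int.cast_one, neg_mul, one_mul] at h2
      refine max_le h.l_le ?_
      rw [div_le_iff_of_neg (by linarith)]; linarith
    · exact h.l_le
  · simp only [ConfInterval.update, userArm]
    split_ifs with h1 h2 h2
    · simp only [Units.val_one, Int.cast_one, one_mul] at h2
      exact le_min h.le_u (by rw [le_div_iff_of_neg h2]; linarith)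
    · exact h.le_u
    · simp only [Units.val_neg, Units.val_one, Int.cast_neg, Int.cast_one, neg_mul, one_mul] at h2
      refine le_min h.le_u ?_
      rw [le_div_iff₀ (by linarith)]; linarith
    · exact h.le_u

/-! ### The posterior mean after each message -/

theorem roundMean_of_lt {C x z : ℝ} {I : ConfInterval} (h : C * I.width < x * I.mid + z) :
    roundMean C I x z = ∫ z, z ∂(ProbabilityTheory.cond (gaussianReal 0 1)
      (Set.Ioi (C * I.width - x * I.mid))) := by
  have e : policySignal C I x ⁻¹' {policySignal C I x z} = Set.Ioi (C * I.width - x * I.mid) := by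
    ext y
    simp only [policySignal, ternarySignal, h, if_true, Set.mem_preimage, Set.mem_singleton_iff,
      Set.mem_Ioi]
    split_ifs with h1 h2 <;> simp <;> linarith
  rw [roundMean, posteriorMean, posterior, e]

theorem roundMean_of_lt_neg {C x z : ℝ} {I : ConfInterval} (h0 : 0 ≤ C * I.width)
    (h : x * I.mid + z < -(C * I.width)) :
    roundMean C I x z = ∫ z, z ∂(ProbabilityTheory.cond (gaussianReal 0 1)
      (Set.Iio (-(C * I.width) - x * I.mid))) := by
  have e : policySignal C I x ⁻¹' {policySignal C I x z}
      = Set.Iio (-(C * I.width) - x * I.mid) := by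
    ext y
    simp only [policySignal, ternarySignal, h, if_true, Set.mem_preimage, Set.mem_singleton_iff,
      Set.mem_Iio, if_neg (show ¬ C * I.width < x * I.mid + z by linarith)]
    split_ifs with h1 h2 <;> simp <;> linarith
  rw [roundMean, posteriorMean, posterior, e]

theorem roundMean_of_abs_le {C x z : ℝ} {I : ConfInterval}
    (h : |x * I.mid + z| ≤ C * I.width) :
    roundMean C I x z = ∫ z, z ∂(ProbabilityTheory.cond (gaussianReal 0 1)
      (Set.Icc (-(C * I.width) - x * I.mid) (C * I.width - x * I.mid))) := by
  rw [abs_le] at h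
  have e : policySignal C I x ⁻¹' {policySignal C I x z}
      = Set.Icc (-(C * I.width) - x * I.mid) (C * I.width - x * I.mid) := by
    ext y
    simp only [policySignal, ternarySignal, Set.mem_preimage, Set.mem_singleton_iff,
      Set.mem_Icc, if_neg (show ¬ C * I.width < x * I.mid + z by linarith),
      if_neg (show ¬ x * I.mid + z < -(C * I.width) by linarith)]
    split_ifs with h1 h2 <;> simp
    · intro; linarith
    · intro; linarith
    · constructor <;> linarith
  rw [roundMean, posteriorMean, posterior, e]

/-! ### Pointwise bounds for one round -/

theorem regret_one (θ x z : ℝ) : regret θ x z 1 = max 0 (-(x * θ + z)) := by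
  have h : (-1 : ℤˣ) ≠ 1 := by decide
  simp only [regret, payoff, if_true, if_neg h]
  rcases le_total 0 (x * θ + z) with h | h
  · rw [max_eq_left h, max_eq_left (by linarith)]; ring
  · rw [max_eq_right h, max_eq_right (by linarith)]; ring

theorem regret_neg_one (θ x z : ℝ) : regret θ x z (-1) = max 0 (x * θ + z) := by
  have h : (-1 : ℤˣ) ≠ 1 := by decide
  simp only [regret, payoff, if_true, if_neg h, sub_zero, max_comm]

theorem regret_nonneg (θ x z : ℝ) (b : ℤˣ) : 0 ≤ regret θ x z b := by
  rcases Int.units_eq_one_or b with rfl | rfl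
  · rw [regret_one]; exact le_max_left _ _
  · rw [regret_neg_one]; exact le_max_left _ _

theorem regret_le_abs (θ x z : ℝ) (b : ℤˣ) : regret θ x z b ≤ |x * θ + z| := by
  rcases Int.units_eq_one_or b with rfl | rfl
  · rw [regret_one]; exact max_le (abs_nonneg _) (neg_le_abs _)
  · rw [regret_neg_one]; exact max_le (abs_nonneg _) (le_abs_self _)

/-- If the user deviates from a message `±1`, then the context is large compared with the
width of the confidence interval. -/
theorem regret_le_of_deviation {C θ x z c : ℝ} {I : ConfInterval} (hC : 0 < C)
    (hI : I.Admissible θ) (hc : |c| ≤ C * I.width + |x * I.mid|)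
    (h : 3 / 16 / (1 + |c|) ≤ |x| * I.width / 2) (b : ℤˣ) :
    regret θ x z b ≤ I.width ^ 2 * (9 * (1 + 2 * C) ^ 2 * ((1 + |x|) ^ 5 * (1 + |z|))) := by
  have hw := hI.width_nonneg
  have hw2 := hI.width_le_two
  have hx := abs_nonneg x
  have hz := abs_nonneg z
  have hc0 := abs_nonneg c
  have hm : |x * I.mid| ≤ |x| := by
    rw [abs_mul]; exact mul_le_of_le_one_right hx hI.abs_mid_le
  have hc1 : 1 + |c| ≤ (1 + 2 * C) * (1 + |x|) := by nlinarith [mul_nonneg hC.le hx]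
  have h1 : 1 ≤ 3 * (1 + 2 * C) * (1 + |x|) ^ 2 * I.width := by
    rw [div_le_iff₀ (by positivity)] at h
    have h2 : |x| * I.width / 2 * (1 + |c|)
        ≤ (1 + |x|) * I.width / 2 * ((1 + 2 * C) * (1 + |x|)) := by gcongr; linarith
    have h3 : 0 ≤ (1 + 2 * C) * (1 + |x|) ^ 2 * I.width := by positivity
    nlinarith
  -- Squaring gives the required order `w ^ 2`; the exponent `5` is one from the payoff and four
  -- from this factor.
  have h2 : 1 ≤ (3 * (1 + 2 * C) * (1 + |x|) ^ 2 * I.width) ^ 2 := one_le_pow₀ h1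
  have hθ : |θ| ≤ 1 := abs_le.2 ⟨hI.neg_one_le.trans hI.l_le, hI.le_u.trans hI.le_one⟩
  have h3 : |x * θ + z| ≤ (1 + |x|) * (1 + |z|) := by
    have := abs_add_le (x * θ) z
    rw [abs_mul] at this
    nlinarith
  calc regret θ x z b ≤ (1 + |x|) * (1 + |z|) * 1 := by
        rw [mul_one]; exact (regret_le_abs _ _ _ _).trans h3
    _ ≤ (1 + |x|) * (1 + |z|) * (3 * (1 + 2 * C) * (1 + |x|) ^ 2 * I.width) ^ 2 := by gcongr
    _ = _ := by ring

/-- Either the dynamic payoff is close to indifference and the regret is of the order of the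
width, or the regret is of the order of the squared width. -/
theorem regret_roundArm_le {C θ : ℝ} {I : ConfInterval} (hC : 0 < C) (hI : I.Admissible θ)
    (x z : ℝ) :
    (z ∈ Set.Icc (-(x * I.mid) - (C + |x| / 2) * I.width)
        (-(x * I.mid) + (C + |x| / 2) * I.width) ∧
      regret θ x z (roundArm C θ I x z) ≤ 2 * ((C + |x| / 2) * I.width)) ∨
    regret θ x z (roundArm C θ I x z)
      ≤ I.width ^ 2 * (9 * (1 + 2 * C) ^ 2 * ((1 + |x|) ^ 5 * (1 + |z|))) := by
  have hw := hI.width_nonneg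
  have hε : 0 ≤ C * I.width := mul_nonneg hC.le hw
  have hd : 0 ≤ |x| * I.width := mul_nonneg (abs_nonneg x) hw
  have hθ := abs_le.1 (hI.abs_mul_sub_mid_le x)
  have hpos : 0 ≤ I.width ^ 2 * (9 * (1 + 2 * C) ^ 2 * ((1 + |x|) ^ 5 * (1 + |z|))) := by
    positivity
  rcases lt_or_ge (C * I.width) (x * I.mid + z) with h1 | h1
  · by_cases hb : 0 < x * θ + roundMean C I x z
    · rw [show roundArm C θ I x z = 1 from if_pos hb, regret_one]
      rcases le_total 0 (x * θ + z) with h2 | h2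
      · right; rw [max_eq_left (by linarith)]; exact hpos
      · left
        rw [max_eq_right (by linarith)]
        refine ⟨⟨?_, ?_⟩, ?_⟩ <;> nlinarith
    · right
      -- Deviation means `x θ + Z ≤ 0`, while `Z` exceeds the cutoff by the mean excess. Hence the
      -- excess is at most `|x (θ - m)|`.
      have h2 := le_integral_cond_Ioi (C * I.width - x * I.mid)
      rw [← roundMean_of_lt h1] at h2
      refine regret_le_of_deviation hC hI (c := C * I.width - x * I.mid) ?_ ?_ _
      · exact (abs_sub _ _).trans (by rw [abs_of_nonneg hε])
      · nlinarith
  rcases lt_or_ge (x * I.mid + z) (-(C * I.width)) with h3 | h3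
  · by_cases hb : 0 < x * θ + roundMean C I x z
    · right
      have h2 := integral_cond_Iio_le (-(C * I.width) - x * I.mid)
      rw [← roundMean_of_lt_neg hε h3] at h2
      refine regret_le_of_deviation hC hI (c := -(C * I.width) - x * I.mid) ?_ ?_ _
      · exact (abs_sub _ _).trans (by rw [abs_neg, abs_of_nonneg hε])
      · nlinarith
    · rw [show roundArm C θ I x z = -1 from if_neg hb, regret_neg_one]
      rcases le_total 0 (x * θ + z) with h2 | h2
      · left
        rw [max_eq_right (by linarith)]
        refine ⟨⟨?_, ?_⟩, ?_⟩ <;> nlinarith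
      · right; rw [max_eq_left (by linarith)]; exact hpos
  -- Message `0`: `|x m + z|` is at most `C w`, and replacing `m` by `θ` costs at most `|x| w / 2`,
  -- whichever arm is chosen.
  · left
    refine ⟨⟨by nlinarith, by nlinarith⟩, (regret_le_abs _ _ _ _).trans ?_⟩
    rw [abs_le]; constructor <;> nlinarith

/-- After a message `0` in a round with a large context the interval shrinks. -/
theorem width_update_le_of_abs_le {C θ x z : ℝ} {I : ConfInterval} (hC : 0 < C)
    (hI : I.Admissible θ) (hx : 4 * C ≤ x)
    (hz : |x * I.mid + z| ≤ C * I.width) :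
    (I.update x (roundMean C I x z) (roundArm C θ I x z)).width ≤ 3 / 4 * I.width := by
  -- At width zero the message-`0` set is a null set and conditioning on it says nothing, but the
  -- claim is trivial.
  rcases hI.width_nonneg.eq_or_lt with h0 | hw
  · have := I.width_update_le x (roundMean C I x z) (roundArm C θ I x z)
    rw [← h0] at this ⊢
    linarith
  have hx0 : 0 < x := by linarith
  have hZ := integral_cond_Icc_mem
    (show -(C * I.width) - x * I.mid < C * I.width - x * I.mid by nlinarith)
  rw [← roundMean_of_abs_le hz] at hZ
  set Z := roundMean C I x z
  -- `-Z / x` differs from the midpoint by at most `C w / x`, which is at most `w / 4` since `x ≥ 4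
  -- C`.
  have h1 : I.mid - I.width / 4 ≤ -Z / x := by
    rw [le_div_iff₀ hx0]; nlinarith [hZ.2]
  have h2 : -Z / x ≤ I.mid + I.width / 4 := by
    rw [div_le_iff₀ hx0]; nlinarith [hZ.1]
  rcases Int.units_eq_one_or (roundArm C θ I x z) with hb | hb
  · have h3 := (le_max_right I.l (-Z / x))
    have h4 : (I.update x Z (roundArm C θ I x z)).l = max I.l (-Z / x) := by
      simp [ConfInterval.update, hb, hx0]
    have h5 := I.update_le_u x Z (roundArm C θ I x z)
    simp only [ConfInterval.width, ConfInterval.mid] at *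
    linarith
  · have h3 := (min_le_right I.u (-Z / x))
    have h4 : (I.update x Z (roundArm C θ I x z)).u = min I.u (-Z / x) := by
      simp [ConfInterval.update, hb, hx0]
    have h5 := I.l_le_update x Z (roundArm C θ I x z)
    simp only [ConfInterval.width, ConfInterval.mid] at *
    linarith

/-! ### Measurability of a round -/

theorem measurable_integral_cond_gaussianReal {α : Type*} [MeasurableSpace α] {S : Set (α × ℝ)}
    (hS : MeasurableSet S) :
    Measurable fun a => ∫ z, z ∂(ProbabilityTheory.cond (gaussianReal 0 1) (Prod.mk a ⁻¹' S)) := by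
  simp_rw [integral_cond_gaussianReal]
  refine Measurable.mul (Measurable.inv ?_) ?_
  · exact (measurable_measure_prodMk_left hS).ennreal_toReal
  · have h : StronglyMeasurable (Function.uncurry fun (a : α) (z : ℝ) =>
        (Prod.mk a ⁻¹' S).indicator (fun z => z) z) :=
      (measurable_snd.indicator hS).stronglyMeasurable
    have e : (fun a => ∫ z in Prod.mk a ⁻¹' S, z ∂gaussianReal 0 1)
        = fun a => ∫ z, (Prod.mk a ⁻¹' S).indicator (fun z => z) z ∂gaussianReal 0 1 := by
      ext a
      exact (integral_indicator (measurable_prodMk_left hS)).symm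
    rw [e]
    exact (h.integral_prod_right (ν := gaussianReal 0 1)).measurable

theorem measurable_roundMean (C : ℝ) :
    Measurable fun p : (ℝ × ℝ × ℝ) × ℝ => roundMean C ⟨p.1.1, p.1.2.1⟩ p.1.2.2 p.2 := by
  let _ : MeasurableSpace SignType := ⊤
  have hs : Measurable fun p : (ℝ × ℝ × ℝ) × ℝ =>
      policySignal C ⟨p.1.1, p.1.2.1⟩ p.1.2.2 p.2 := by
    simp only [policySignal, ternarySignal, ConfInterval.width, ConfInterval.mid]
    refine Measurable.ite (measurableSet_lt (by fun_prop) (by fun_prop)) measurable_const ?_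
    exact Measurable.ite (measurableSet_lt (by fun_prop) (by fun_prop)) measurable_const
      measurable_const
  -- With the message fixed, the posterior mean no longer depends on `z`, and there are only three
  -- messages.
  have e : (fun p : (ℝ × ℝ × ℝ) × ℝ => roundMean C ⟨p.1.1, p.1.2.1⟩ p.1.2.2 p.2)
      = fun p => ∑ a : SignType, if policySignal C ⟨p.1.1, p.1.2.1⟩ p.1.2.2 p.2 = a then
          posteriorMean (policySignal C ⟨p.1.1, p.1.2.1⟩ p.1.2.2) a else 0 := by
    ext p
    simp [roundMean]
  rw [e]
  refine Finset.measurable_sum _ fun a _ => Measurable.ite ?_ ?_ measurable_const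
  · exact hs (MeasurableSpace.measurableSet_top (s := {a}))
  · exact (measurable_integral_cond_gaussianReal
      (hs (MeasurableSpace.measurableSet_top (s := {a})))).comp measurable_fst

theorem measurable_comp_roundArm {C : ℝ} {f : (ℝ × ℝ × ℝ) × ℝ × ℝ → ℤˣ → ℝ}
    (hf : ∀ b, Measurable fun p => f p b) :
    Measurable fun p => f p (roundArm C p.1.1 ⟨p.1.2.1, p.1.2.2⟩ p.2.1 p.2.2) := by
  have hZ : Measurable fun p : (ℝ × ℝ × ℝ) × ℝ × ℝ =>
      roundMean C ⟨p.1.2.1, p.1.2.2⟩ p.2.1 p.2.2 :=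
    (measurable_roundMean C).comp (g := _)
      (f := fun p : (ℝ × ℝ × ℝ) × ℝ × ℝ => ((p.1.2.1, p.1.2.2, p.2.1), p.2.2)) (by fun_prop)
  simp only [roundArm, userArm, apply_ite]
  exact Measurable.ite (measurableSet_lt measurable_const (by fun_prop)) (hf 1) (hf (-1))

/-- The regret of a round that starts with state `s.1` and interval `[s.2.1, s.2.2]` and in which
the context is `v.1` and the dynamic payoff is `v.2`. -/
noncomputable def roundRegret (C : ℝ) (s : ℝ × ℝ × ℝ) (v : ℝ × ℝ) : ℝ :=
  regret s.1 v.1 v.2 (roundArm C s.1 ⟨s.2.1, s.2.2⟩ v.1 v.2)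

/-- The interval after such a round. -/
noncomputable def roundUpdate (C : ℝ) (s : ℝ × ℝ × ℝ) (v : ℝ × ℝ) : ConfInterval :=
  ConfInterval.update ⟨s.2.1, s.2.2⟩ v.1 (roundMean C ⟨s.2.1, s.2.2⟩ v.1 v.2)
    (roundArm C s.1 ⟨s.2.1, s.2.2⟩ v.1 v.2)

theorem measurable_roundRegret (C : ℝ) :
    Measurable fun p : (ℝ × ℝ × ℝ) × ℝ × ℝ => roundRegret C p.1 p.2 := by
  refine measurable_comp_roundArm (f := fun p b => regret p.1.1 p.2.1 p.2.2 b) fun b => ?_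
  rcases Int.units_eq_one_or b with rfl | rfl
  · simp only [regret_one]; fun_prop
  · simp only [regret_neg_one]; fun_prop

theorem measurable_roundUpdate_l (C : ℝ) :
    Measurable fun p : (ℝ × ℝ × ℝ) × ℝ × ℝ => (roundUpdate C p.1 p.2).l := by
  have hZ : Measurable fun p : (ℝ × ℝ × ℝ) × ℝ × ℝ =>
      roundMean C ⟨p.1.2.1, p.1.2.2⟩ p.2.1 p.2.2 :=
    (measurable_roundMean C).comp (g := _)
      (f := fun p : (ℝ × ℝ × ℝ) × ℝ × ℝ => ((p.1.2.1, p.1.2.2, p.2.1), p.2.2)) (by fun_prop)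
  refine measurable_comp_roundArm (f := fun p b => (ConfInterval.update ⟨p.1.2.1, p.1.2.2⟩ p.2.1
    (roundMean C ⟨p.1.2.1, p.1.2.2⟩ p.2.1 p.2.2) b).l) fun b => ?_
  exact Measurable.ite (measurableSet_lt measurable_const (by fun_prop)) (by fun_prop)
    (by fun_prop)

theorem measurable_roundUpdate_u (C : ℝ) :
    Measurable fun p : (ℝ × ℝ × ℝ) × ℝ × ℝ => (roundUpdate C p.1 p.2).u := by
  have hZ : Measurable fun p : (ℝ × ℝ × ℝ) × ℝ × ℝ =>
      roundMean C ⟨p.1.2.1, p.1.2.2⟩ p.2.1 p.2.2 :=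
    (measurable_roundMean C).comp (g := _)
      (f := fun p : (ℝ × ℝ × ℝ) × ℝ × ℝ => ((p.1.2.1, p.1.2.2, p.2.1), p.2.2)) (by fun_prop)
  refine measurable_comp_roundArm (f := fun p b => (ConfInterval.update ⟨p.1.2.1, p.1.2.2⟩ p.2.1
    (roundMean C ⟨p.1.2.1, p.1.2.2⟩ p.2.1 p.2.2) b).u) fun b => ?_
  exact Measurable.ite (measurableSet_lt (by fun_prop) measurable_const) (by fun_prop)
    (by fun_prop)

/-! ### Expected regret and expected loss of width in one round -/

/-- The law of the context and the dynamic payoff of a round. -/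
noncomputable abbrev roundLaw : Measure (ℝ × ℝ) := (gaussianReal 0 1).prod (gaussianReal 0 1)

/-- The expected regret of a round is of the order of the squared width. -/
theorem exists_lintegral_roundRegret_le {C : ℝ} (hC : 0 < C) :
    ∃ K : ENNReal, K ≠ ⊤ ∧ ∀ s : ℝ × ℝ × ℝ,
      ConfInterval.Admissible ⟨s.2.1, s.2.2⟩ s.1 →
      ∫⁻ v, ENNReal.ofReal (roundRegret C s v) ∂roundLaw
        ≤ ENNReal.ofReal ((s.2.2 - s.2.1) ^ 2) * K := by
  set γ := gaussianReal 0 1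
  set M := ∫⁻ z, ENNReal.ofReal (1 + |z|) ∂γ with hM
  have hMfin : M < ⊤ := by
    simpa using lintegral_gaussianReal_one_add_abs_pow_lt_top 1
  -- The first term is the near-indifference band, with mass and regret both at most `2 a` for `a =
  -- (C + |x| / 2) w`; the second is deviation.
  refine ⟨∫⁻ x, (ENNReal.ofReal (4 * (C + 1) ^ 2) * ENNReal.ofReal ((1 + |x|) ^ 2)
    + ENNReal.ofReal (9 * (1 + 2 * C) ^ 2) * ENNReal.ofReal ((1 + |x|) ^ 5) * M) ∂γ, ?_, ?_⟩
  · rw [lintegral_add_left (by fun_prop), lintegral_const_mul _ (by fun_prop),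
      lintegral_mul_const _ (by fun_prop), lintegral_const_mul _ (by fun_prop)]
    have h2 := (lintegral_gaussianReal_one_add_abs_pow_lt_top 2).ne
    have h5 := (lintegral_gaussianReal_one_add_abs_pow_lt_top 5).ne
    exact ENNReal.add_ne_top.2 ⟨ENNReal.mul_ne_top ENNReal.ofReal_ne_top h2,
      ENNReal.mul_ne_top (ENNReal.mul_ne_top ENNReal.ofReal_ne_top h5) hMfin.ne⟩
  · intro s hs
    set I : ConfInterval := ⟨s.2.1, s.2.2⟩ with hI
    have hw : 0 ≤ I.width := hs.width_nonneg
    refine (lintegral_prod_le _).trans ?_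
    rw [← lintegral_const_mul _ (by fun_prop)]
    refine lintegral_mono fun x => ?_
    have hx := abs_nonneg x
    set a := (C + |x| / 2) * I.width with ha
    have ha0 : 0 ≤ a := by positivity
    calc ∫⁻ z, ENNReal.ofReal (roundRegret C s (x, z)) ∂γ
        ≤ ∫⁻ z, ((Set.Icc (-(x * I.mid) - a) (-(x * I.mid) + a)).indicator
            (fun _ => ENNReal.ofReal (2 * a)) z
          + ENNReal.ofReal (I.width ^ 2 * (9 * (1 + 2 * C) ^ 2 * (1 + |x|) ^ 5))
            * ENNReal.ofReal (1 + |z|)) ∂γ := by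
          refine lintegral_mono fun z => ?_
          rcases regret_roundArm_le hC hs x z with ⟨h1, h2⟩ | h
          · rw [Set.indicator_of_mem h1]
            exact (ENNReal.ofReal_le_ofReal h2).trans le_self_add
          · refine le_trans ?_ le_add_self
            rw [← ENNReal.ofReal_mul (by positivity)]
            refine ENNReal.ofReal_le_ofReal (h.trans (le_of_eq ?_))
            ring
      _ = ENNReal.ofReal (2 * a) * γ (Set.Icc (-(x * I.mid) - a) (-(x * I.mid) + a))
          + ENNReal.ofReal (I.width ^ 2 * (9 * (1 + 2 * C) ^ 2 * (1 + |x|) ^ 5)) * M := by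
          rw [lintegral_add_left (measurable_const.indicator measurableSet_Icc),
            lintegral_indicator_const measurableSet_Icc, lintegral_const_mul _ (by fun_prop)]
      _ ≤ ENNReal.ofReal (I.width ^ 2 * (4 * (C + 1) ^ 2 * (1 + |x|) ^ 2))
          + ENNReal.ofReal (I.width ^ 2 * (9 * (1 + 2 * C) ^ 2 * (1 + |x|) ^ 5)) * M := by
          gcongr
          refine (mul_le_mul_right (gaussianReal_Icc_le _ _) _).trans ?_
          rw [← ENNReal.ofReal_mul (by positivity)]
          refine ENNReal.ofReal_le_ofReal ?_
          have h1 : C + |x| / 2 ≤ (C + 1) * (1 + |x|) := by nlinarith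
          have h2 : (C + |x| / 2) ^ 2 ≤ ((C + 1) * (1 + |x|)) ^ 2 := by gcongr
          have h3 := mul_le_mul_of_nonneg_left h2 (sq_nonneg I.width)
          rw [ha]
          nlinarith
      _ = _ := by
          change _ = ENNReal.ofReal (I.width ^ 2) * _
          rw [ENNReal.ofReal_mul (sq_nonneg _), ENNReal.ofReal_mul (sq_nonneg _),
            ENNReal.ofReal_mul (p := 4 * (C + 1) ^ 2) (by positivity),
            ENNReal.ofReal_mul (p := 9 * (1 + 2 * C) ^ 2) (by positivity)]
          ring

/-- A round decreases the expected width by at least the order of the squared width. -/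
theorem exists_lintegral_width_roundUpdate_add_le {C : ℝ} (hC : 0 < C) :
    ∃ p : ℝ, 0 < p ∧ ∀ s : ℝ × ℝ × ℝ,
      ConfInterval.Admissible ⟨s.2.1, s.2.2⟩ s.1 →
      ∫⁻ v, ENNReal.ofReal (roundUpdate C s v).width ∂roundLaw
        + ENNReal.ofReal (p * (s.2.2 - s.2.1) ^ 2) ≤ ENNReal.ofReal (s.2.2 - s.2.1) := by
  set γ := gaussianReal 0 1
  -- For `x ≤ 4 C + 1` and `w ≤ 2`, the message-`0` interval lies in `[-R, R]`, as `|x m| ≤ 4 C + 1`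
  -- and `C w ≤ 2 C`.
  set R := 4 * C + 1 + 2 * C
  set q := γ.real (Set.Icc (4 * C) (4 * C + 1)) with hq
  have hq0 : 0 < q := by
    refine ENNReal.toReal_pos (fun h => ?_) (measure_ne_top _ _)
    have := gaussianReal_absolutelyContinuous' 0 one_ne_zero h
    simp at this
  have hφ := gaussianPDFReal_pos 0 1 R one_ne_zero
  -- Mass of the contexts, times density bound and length `2 C w` of the message-`0` interval, times
  -- the loss `w / 4`.
  refine ⟨gaussianPDFReal 0 1 R * (2 * C) * q / 4, by positivity, fun s hs => ?_⟩
  set I : ConfInterval := ⟨s.2.1, s.2.2⟩ with hI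
  change _ + ENNReal.ofReal (_ * I.width ^ 2) ≤ ENNReal.ofReal I.width
  have hw : 0 ≤ I.width := hs.width_nonneg
  have hw2 := hs.width_le_two
  set A : Set (ℝ × ℝ) := {v | v.1 ∈ Set.Icc (4 * C) (4 * C + 1) ∧ |v.1 * I.mid + v.2| ≤ C * I.width}
  have hA : MeasurableSet A :=
    (measurable_fst measurableSet_Icc).inter (measurableSet_le
      (f := fun v : ℝ × ℝ => |v.1 * I.mid + v.2|) (by fun_prop) measurable_const)
  have hP : ENNReal.ofReal (gaussianPDFReal 0 1 R * (2 * C) * q * I.width) ≤ roundLaw A := by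
    rw [Measure.prod_apply hA]
    have h1 : ENNReal.ofReal (gaussianPDFReal 0 1 R * (2 * C) * q * I.width)
        = ∫⁻ x in Set.Icc (4 * C) (4 * C + 1),
            ENNReal.ofReal (gaussianPDFReal 0 1 R) * ENNReal.ofReal (2 * C * I.width) ∂γ := by
      rw [setLIntegral_const, ← ofReal_measureReal, ← hq, ← ENNReal.ofReal_mul hφ.le,
        ← ENNReal.ofReal_mul (by positivity)]
      congr 1; ring
    rw [h1, ← lintegral_indicator measurableSet_Icc]
    refine lintegral_mono fun x => Set.indicator_le
      (g := fun x => γ (Prod.mk x ⁻¹' A)) (fun x hx => ?_) x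
    have hx0 : 0 ≤ x := by linarith [hx.1]
    have hxm : |x * I.mid| ≤ 4 * C + 1 := by
      rw [abs_mul, abs_of_nonneg hx0]
      exact (mul_le_of_le_one_right hx0 hs.abs_mid_le).trans hx.2
    have hCw : C * I.width ≤ 2 * C := by nlinarith
    rw [abs_le] at hxm
    have h2 := le_gaussianReal_Icc (a := -(C * I.width) - x * I.mid) (b := C * I.width - x * I.mid)
      (R := R) (by simp only [R]; linarith) (by simp only [R]; linarith)
    rw [show C * I.width - x * I.mid - (-(C * I.width) - x * I.mid) = 2 * C * I.width by ring] at h2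
    refine h2.trans (measure_mono fun z hz => ⟨hx, ?_⟩)
    rw [abs_le]
    constructor <;> linarith [hz.1, hz.2]
  calc ∫⁻ v, ENNReal.ofReal (roundUpdate C s v).width ∂roundLaw
        + ENNReal.ofReal (gaussianPDFReal 0 1 R * (2 * C) * q / 4 * I.width ^ 2)
      ≤ ∫⁻ v, ENNReal.ofReal (roundUpdate C s v).width ∂roundLaw
        + ENNReal.ofReal (I.width / 4) * roundLaw A := by
        gcongr
        refine le_trans (le_of_eq ?_) (mul_le_mul_right hP _)
        rw [← ENNReal.ofReal_mul (by positivity)]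
        congr 1; ring
    _ = ∫⁻ v, (ENNReal.ofReal (roundUpdate C s v).width
        + A.indicator (fun _ => ENNReal.ofReal (I.width / 4)) v) ∂roundLaw := by
        rw [lintegral_add_right _ (measurable_const.indicator hA), lintegral_indicator_const hA]
    _ ≤ ∫⁻ _, ENNReal.ofReal I.width ∂roundLaw := by
        refine lintegral_mono fun v => ?_
        by_cases hv : v ∈ A
        · have := width_update_le_of_abs_le hC hs hv.1.1 hv.2
          have h0 : 0 ≤ (roundUpdate C s v).width := (hs.update _ _).width_nonneg
          rw [Set.indicator_of_mem hv, ← ENNReal.ofReal_add h0 (by positivity)]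
          refine ENNReal.ofReal_le_ofReal ?_
          change (roundUpdate C s v).width ≤ _ at this
          linarith
        · rw [Set.indicator_of_notMem hv, add_zero]
          exact ENNReal.ofReal_le_ofReal (I.width_update_le _ _ _)
    _ = ENNReal.ofReal I.width := by simp

/-- The width of the confidence interval, times a constant, is a potential that pays for the
expected regret. -/
theorem exists_potential {C : ℝ} (hC : 0 < C) :
    ∃ K : ℝ, 0 < K ∧ ∀ s : ℝ × ℝ × ℝ,
      ConfInterval.Admissible ⟨s.2.1, s.2.2⟩ s.1 →
      ∫⁻ v, (ENNReal.ofReal (roundRegret C s v)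
          + ENNReal.ofReal K * ENNReal.ofReal (roundUpdate C s v).width) ∂roundLaw
        ≤ ENNReal.ofReal K * ENNReal.ofReal (s.2.2 - s.2.1) := by
  obtain ⟨K₁, hK₁, h₁⟩ := exists_lintegral_roundRegret_le hC
  obtain ⟨p, hp, h₂⟩ := exists_lintegral_width_roundUpdate_add_le hC
  -- `K₁ / p` already balances cost against gain; the `1` only ensures positivity.
  refine ⟨K₁.toReal / p + 1, by positivity, fun s hs => ?_⟩
  have hr : Measurable fun v => roundRegret C s v :=
    (measurable_roundRegret C).comp measurable_prodMk_left
  rw [lintegral_add_left hr.ennreal_ofReal, lintegral_const_mul' _ _ ENNReal.ofReal_ne_top]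
  refine le_trans ?_ (mul_le_mul_right (h₂ s hs) _)
  rw [mul_add, add_comm]
  gcongr
  refine (h₁ s hs).trans ?_
  rw [← ENNReal.ofReal_toReal hK₁, ← ENNReal.ofReal_mul (sq_nonneg _),
    ← ENNReal.ofReal_mul (by positivity), ENNReal.toReal_ofReal ENNReal.toReal_nonneg]
  refine ENNReal.ofReal_le_ofReal ?_
  have : (K₁.toReal / p + 1) * (p * (s.2.2 - s.2.1) ^ 2)
      = (s.2.2 - s.2.1) ^ 2 * K₁.toReal + p * (s.2.2 - s.2.1) ^ 2 := by
    field_simp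
  rw [this]
  nlinarith [mul_nonneg hp.le (sq_nonneg (s.2.2 - s.2.1))]

/-! ### The policy as a process and the independence of its rounds -/

/-- The state together with the end points of the confidence interval at the beginning of
round `t`. -/
noncomputable def policyState (C θ : ℝ) (x z : ℕ → ℝ) (t : ℕ) : ℝ × ℝ × ℝ :=
  (θ, (confInterval C θ x z t).l, (confInterval C θ x z t).u)

theorem policyState_succ (C θ : ℝ) (x z : ℕ → ℝ) (t : ℕ) :
    policyState C θ x z (t + 1) = (θ, (roundUpdate C (policyState C θ x z t) (x t, z t)).l,
      (roundUpdate C (policyState C θ x z t) (x t, z t)).u) := rfl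

theorem cumRegret_eq_sum (C θ : ℝ) (x z : ℕ → ℝ) (T : ℕ) :
    cumRegret C θ x z T
      = ∑ t ∈ Finset.range T, roundRegret C (policyState C θ x z t) (x t, z t) := rfl

theorem admissible_confInterval {θ : ℝ} (hθ : θ ∈ Set.Icc (-1 : ℝ) 1) (C : ℝ) (x z : ℕ → ℝ)
    (t : ℕ) : (confInterval C θ x z t).Admissible θ := by
  induction t with
  | zero => exact ⟨le_rfl, le_rfl, hθ.1, hθ.2⟩
  | succ t ih => exact ih.update _ _

/-- Only rounds before `t` are assumed measurable and the σ-algebra is arbitrary, so that it can be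
the one generated by `θ` and the past. -/
theorem measurable_policyState {Ω : Type*} [MeasurableSpace Ω] {θ : Ω → ℝ} {x z : ℕ → Ω → ℝ}
    (C : ℝ) (t : ℕ) (hθ : Measurable θ) (hx : ∀ s < t, Measurable (x s))
    (hz : ∀ s < t, Measurable (z s)) :
    Measurable fun ω => policyState C (θ ω) (fun s => x s ω) (fun s => z s ω) t := by
  induction t with
  | zero => exact hθ.prodMk (measurable_const (a := ((-1 : ℝ), (1 : ℝ))))
  | succ t ih =>
    have h : Measurable fun ω => (policyState C (θ ω) (fun s => x s ω) (fun s => z s ω) t,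
        (x t ω, z t ω)) :=
      (ih (fun s hs => hx s (hs.trans t.lt_succ_self))
        (fun s hs => hz s (hs.trans t.lt_succ_self))).prodMk
        ((hx t t.lt_succ_self).prodMk (hz t t.lt_succ_self))
    have hl := (measurable_roundUpdate_l C).comp h
    have hu := (measurable_roundUpdate_u C).comp h
    simp only [policyState_succ]
    exact hθ.prodMk (hl.prodMk hu)

section

variable {Ω : Type*} [MeasurableSpace Ω] {P : Measure Ω} {θ : Ω → ℝ} {x z : ℕ → Ω → ℝ} {T : ℕ}

theorem indepFun_policyState (C : ℝ) {t : ℕ} (ht : t < T) (hθ : Measurable θ)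
    (hx : ∀ t < T, Measurable (x t)) (hz : ∀ t < T, Measurable (z t))
    (hind : iIndepFun (fun i : Option (Fin T ⊕ Fin T) =>
      i.elim θ (Sum.elim (fun t => x t) (fun t => z t))) P) :
    IndepFun (fun ω => policyState C (θ ω) (fun s => x s ω) (fun s => z s ω) t)
      (fun ω => (x t ω, z t ω)) P := by
  set f : Option (Fin T ⊕ Fin T) → Ω → ℝ :=
    fun i => i.elim θ (Sum.elim (fun t => x t) (fun t => z t)) with hf
  have hfm : ∀ i, Measurable (f i) := by
    rintro (_ | i | i)
    · exact hθ
    · exact hx i i.2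
    · exact hz i i.2
  -- The indices of `θ` and of all rounds before `t`.
  let S : Set (Option (Fin T ⊕ Fin T)) :=
    {i | ∀ s : Fin T, t ≤ s → i ≠ some (Sum.inl s) ∧ i ≠ some (Sum.inr s)}
  let S' : Set (Option (Fin T ⊕ Fin T)) := {some (Sum.inl ⟨t, ht⟩), some (Sum.inr ⟨t, ht⟩)}
  have hdisj : Disjoint S S' := by
    rw [Set.disjoint_left]
    rintro i hi (rfl | rfl)
    · exact (hi ⟨t, ht⟩ le_rfl).1 rfl
    · exact (hi ⟨t, ht⟩ le_rfl).2 rfl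
  have key : ∀ (U : Set (Option (Fin T ⊕ Fin T))) (i), i ∈ U →
      Measurable[⨆ j ∈ U, MeasurableSpace.comap (f j) inferInstance] (f i) := fun U i hi =>
    Measurable.mono (comap_measurable (f i))
      (le_iSup₂ (f := fun j (_ : j ∈ U) => MeasurableSpace.comap (f j) inferInstance) i hi) le_rfl
  have hI := indep_iSup_of_disjoint (fun i => (hfm i).comap_le) hind.iIndep hdisj
  rw [IndepFun_iff_Indep]
  refine indep_of_indep_of_le_left (indep_of_indep_of_le_right hI ?_) ?_
  · refine Measurable.comap_le ?_
    exact Measurable.prodMk (key S' _ (Or.inl rfl)) (key S' _ (Or.inr rfl))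
  · refine Measurable.comap_le ?_
    refine @measurable_policyState Ω
      (⨆ j ∈ S, MeasurableSpace.comap (f j) inferInstance) θ x z C t (key S none (by simp [S])) ?_ ?_
    · intro s hs
      refine key S (some (Sum.inl ⟨s, hs.trans ht⟩)) ?_
      intro r hr
      simp only [ne_eq, Option.some.injEq, Sum.inl.injEq, reduceCtorEq, not_false_eq_true, and_true]
      rintro rfl
      exact absurd hs (by simpa using hr)
    · intro s hs
      refine key S (some (Sum.inr ⟨s, hs.trans ht⟩)) ?_
      intro r hr
      simp only [ne_eq, Option.some.injEq, Sum.inr.injEq, reduceCtorEq, not_false_eq_true, true_and]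
      rintro rfl
      exact absurd hs (by simpa using hr)

theorem map_context_payoff_eq_roundLaw [IsProbabilityMeasure P] {t : ℕ} (ht : t < T)
    (hx : HasLaw (x t) (gaussianReal 0 1) P) (hz : HasLaw (z t) (gaussianReal 0 1) P)
    (hind : iIndepFun (fun i : Option (Fin T ⊕ Fin T) =>
      i.elim θ (Sum.elim (fun t => x t) (fun t => z t))) P) :
    P.map (fun ω => (x t ω, z t ω)) = roundLaw := by
  have h : IndepFun (x t) (z t) P :=
    hind.indepFun (i := some (Sum.inl ⟨t, ht⟩)) (j := some (Sum.inr ⟨t, ht⟩)) (by simp)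
  rw [(indepFun_iff_map_prod_eq_prod_map_map hx.aemeasurable hz.aemeasurable).1 h, hx.map_eq,
    hz.map_eq]

/-- Independence and Fubini: the current state can be frozen while the new context and payoff are
averaged out. -/
theorem lintegral_round_eq [IsProbabilityMeasure P] (C : ℝ) {t : ℕ} (ht : t < T)
    (hθ : Measurable θ) (hxm : ∀ t < T, Measurable (x t)) (hzm : ∀ t < T, Measurable (z t))
    (hx : HasLaw (x t) (gaussianReal 0 1) P) (hz : HasLaw (z t) (gaussianReal 0 1) P)
    (hind : iIndepFun (fun i : Option (Fin T ⊕ Fin T) =>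
      i.elim θ (Sum.elim (fun t => x t) (fun t => z t))) P)
    {F : (ℝ × ℝ × ℝ) → ℝ × ℝ → ENNReal} (hF : Measurable (Function.uncurry F)) :
    ∫⁻ ω, F (policyState C (θ ω) (fun s => x s ω) (fun s => z s ω) t) (x t ω, z t ω) ∂P
      = ∫⁻ ω, ∫⁻ v, F (policyState C (θ ω) (fun s => x s ω) (fun s => z s ω) t) v ∂roundLaw ∂P := by
  have hs : Measurable fun ω => policyState C (θ ω) (fun s => x s ω) (fun s => z s ω) t :=
    measurable_policyState C t hθ (fun s h => hxm s (h.trans ht)) (fun s h => hzm s (h.trans ht))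
  have hv : Measurable fun ω => (x t ω, z t ω) := (hxm t ht).prodMk (hzm t ht)
  have hm := (indepFun_iff_map_prod_eq_prod_map_map hs.aemeasurable hv.aemeasurable).1
    (indepFun_policyState C ht hθ hxm hzm hind)
  rw [map_context_payoff_eq_roundLaw ht hx hz hind] at hm
  have h1 := lintegral_map (μ := P) hF (hs.prodMk hv)
  rw [hm, lintegral_prod _ hF.aemeasurable, lintegral_map hF.lintegral_prod_right' hs] at h1
  exact h1.symm

/-! ### Summation over the rounds -/

/-- The expected regret is bounded by the potential of the initial interval. -/
theorem lintegral_cumRegret_le [IsProbabilityMeasure P] {C K : ℝ} (hK : 0 < K)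
    (hpot : ∀ s : ℝ × ℝ × ℝ, ConfInterval.Admissible ⟨s.2.1, s.2.2⟩ s.1 →
      ∫⁻ v, (ENNReal.ofReal (roundRegret C s v)
          + ENNReal.ofReal K * ENNReal.ofReal (roundUpdate C s v).width) ∂roundLaw
        ≤ ENNReal.ofReal K * ENNReal.ofReal (s.2.2 - s.2.1))
    (hθ : Measurable θ) (hxm : ∀ t < T, Measurable (x t)) (hzm : ∀ t < T, Measurable (z t))
    (hθ1 : ∀ᵐ ω ∂P, θ ω ∈ Set.Icc (-1 : ℝ) 1)
    (hx : ∀ t < T, HasLaw (x t) (gaussianReal 0 1) P)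
    (hz : ∀ t < T, HasLaw (z t) (gaussianReal 0 1) P)
    (hind : iIndepFun (fun i : Option (Fin T ⊕ Fin T) =>
      i.elim θ (Sum.elim (fun t => x t) (fun t => z t))) P) :
    ∫⁻ ω, ENNReal.ofReal (cumRegret C (θ ω) (fun t => x t ω) (fun t => z t ω) T) ∂P
      ≤ ENNReal.ofReal (2 * K) := by
  set st : ℕ → Ω → ℝ × ℝ × ℝ := fun t ω =>
    policyState C (θ ω) (fun s => x s ω) (fun s => z s ω) t with hst
  set r : ℕ → Ω → ENNReal := fun t ω => ENNReal.ofReal (roundRegret C (st t ω) (x t ω, z t ω))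
  set w : ℕ → Ω → ENNReal := fun t ω =>
    ENNReal.ofReal K * ENNReal.ofReal ((st t ω).2.2 - (st t ω).2.1)
  have hrm : ∀ t < T, Measurable (r t) := fun t ht =>
    ((measurable_roundRegret C).comp
      ((measurable_policyState C t hθ (fun s h => hxm s (h.trans ht))
        (fun s h => hzm s (h.trans ht))).prodMk ((hxm t ht).prodMk (hzm t ht)))).ennreal_ofReal
  have hF : Measurable (Function.uncurry fun (s : ℝ × ℝ × ℝ) (v : ℝ × ℝ) =>
      ENNReal.ofReal (roundRegret C s v)
        + ENNReal.ofReal K * ENNReal.ofReal (roundUpdate C s v).width) :=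
    (measurable_roundRegret C).ennreal_ofReal.add
      (((measurable_roundUpdate_u C).sub (measurable_roundUpdate_l C)).ennreal_ofReal.const_mul _)
  have hstep : ∀ t < T, ∫⁻ ω, r t ω ∂P + ∫⁻ ω, w (t + 1) ω ∂P ≤ ∫⁻ ω, w t ω ∂P := by
    intro t ht
    rw [← lintegral_add_left (hrm t ht)]
    refine (lintegral_round_eq C ht hθ hxm hzm (hx t ht) (hz t ht) hind hF).trans_le ?_
    refine lintegral_mono_ae ?_
    filter_upwards [hθ1] with ω hω
    exact hpot _ (admissible_confInterval hω C _ _ t)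
  -- Telescoping, with the remaining potential kept on the left until the end.
  have hsum : ∀ n ≤ T, ∑ t ∈ Finset.range n, ∫⁻ ω, r t ω ∂P + ∫⁻ ω, w n ω ∂P ≤ ∫⁻ ω, w 0 ω ∂P := by
    intro n
    induction n with
    | zero => simp
    | succ n ih =>
      intro hn
      rw [Finset.sum_range_succ, add_assoc]
      exact (add_le_add_right (hstep n (by lia)) _).trans (ih (by lia))
  have hw0 : ∫⁻ ω, w 0 ω ∂P = ENNReal.ofReal (2 * K) := by
    have : ∀ ω, w 0 ω = ENNReal.ofReal (2 * K) := fun ω => by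
      simp only [w, hst, policyState, confInterval]
      rw [← ENNReal.ofReal_mul hK.le]
      congr 1; ring
    simp [this]
  calc ∫⁻ ω, ENNReal.ofReal (cumRegret C (θ ω) (fun t => x t ω) (fun t => z t ω) T) ∂P
      = ∫⁻ ω, ∑ t ∈ Finset.range T, r t ω ∂P := by
        refine lintegral_congr fun ω => ?_
        rw [cumRegret_eq_sum, ENNReal.ofReal_sum_of_nonneg]
        exact fun t _ => regret_nonneg _ _ _ _
    _ = ∑ t ∈ Finset.range T, ∫⁻ ω, r t ω ∂P :=
        lintegral_finsetSum' _ fun t ht => (hrm t (Finset.mem_range.1 ht)).aemeasurable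
    _ ≤ ENNReal.ofReal (2 * K) := le_self_add.trans ((hsum T le_rfl).trans_eq hw0)

theorem measurable_cumRegret (C : ℝ) (hθ : Measurable θ) (hxm : ∀ t < T, Measurable (x t))
    (hzm : ∀ t < T, Measurable (z t)) :
    Measurable fun ω => cumRegret C (θ ω) (fun t => x t ω) (fun t => z t ω) T := by
  simp only [cumRegret_eq_sum]
  refine Finset.measurable_sum _ fun t ht => ?_
  have ht := Finset.mem_range.1 ht
  exact (measurable_roundRegret C).comp
    ((measurable_policyState C t hθ (fun s h => hxm s (h.trans ht))
      (fun s h => hzm s (h.trans ht))).prodMk ((hxm t ht).prodMk (hzm t ht)))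

theorem cumRegret_nonneg (C θ : ℝ) (x z : ℕ → ℝ) (T : ℕ) : 0 ≤ cumRegret C θ x z T :=
  Finset.sum_nonneg fun _ _ => regret_nonneg _ _ _ _

theorem confInterval_congr (C θ : ℝ) {x z x' z' : ℕ → ℝ} {t : ℕ} (hx : ∀ s < t, x s = x' s)
    (hz : ∀ s < t, z s = z' s) : confInterval C θ x z t = confInterval C θ x' z' t := by
  induction t with
  | zero => rfl
  | succ t ih =>
    simp only [confInterval]
    rw [ih (fun s h => hx s (by lia)) (fun s h => hz s (by lia)), hx t (by lia), hz t (by lia)]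

theorem cumRegret_congr (C θ : ℝ) {x z x' z' : ℕ → ℝ} {T : ℕ} (hx : ∀ s < T, x s = x' s)
    (hz : ∀ s < T, z s = z' s) : cumRegret C θ x z T = cumRegret C θ x' z' T := by
  refine Finset.sum_congr rfl fun t ht => ?_
  have ht := Finset.mem_range.1 ht
  rw [confInterval_congr C θ (fun s h => hx s (h.trans ht)) (fun s h => hz s (h.trans ht)),
    hx t ht, hz t ht]

theorem integrable_cumRegret_and_integral_le_of_measurable [IsProbabilityMeasure P] {C K : ℝ}
    (hK : 0 < K)
    (hpot : ∀ s : ℝ × ℝ × ℝ, ConfInterval.Admissible ⟨s.2.1, s.2.2⟩ s.1 →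
      ∫⁻ v, (ENNReal.ofReal (roundRegret C s v)
          + ENNReal.ofReal K * ENNReal.ofReal (roundUpdate C s v).width) ∂roundLaw
        ≤ ENNReal.ofReal K * ENNReal.ofReal (s.2.2 - s.2.1))
    (hθ : Measurable θ) (hxm : ∀ t < T, Measurable (x t)) (hzm : ∀ t < T, Measurable (z t))
    (hθ1 : ∀ᵐ ω ∂P, θ ω ∈ Set.Icc (-1 : ℝ) 1)
    (hx : ∀ t < T, HasLaw (x t) (gaussianReal 0 1) P)
    (hz : ∀ t < T, HasLaw (z t) (gaussianReal 0 1) P)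
    (hind : iIndepFun (fun i : Option (Fin T ⊕ Fin T) =>
      i.elim θ (Sum.elim (fun t => x t) (fun t => z t))) P) :
    Integrable (fun ω => cumRegret C (θ ω) (fun t => x t ω) (fun t => z t ω) T) P ∧
      ∫ ω, cumRegret C (θ ω) (fun t => x t ω) (fun t => z t ω) T ∂P ≤ 2 * K := by
  have h := lintegral_cumRegret_le hK hpot hθ hxm hzm hθ1 hx hz hind
  have hm := (measurable_cumRegret C hθ hxm hzm).aestronglyMeasurable (μ := P)
  have h0 : 0 ≤ᵐ[P] fun ω => cumRegret C (θ ω) (fun t => x t ω) (fun t => z t ω) T :=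
    ae_of_all _ fun _ => cumRegret_nonneg _ _ _ _ _
  refine ⟨⟨hm, ?_⟩, ?_⟩
  · rw [hasFiniteIntegral_iff_ofReal h0]
    exact h.trans_lt ENNReal.ofReal_lt_top
  · rw [integral_eq_lintegral_of_nonneg_ae h0 hm]
    exact ENNReal.toReal_le_of_le_ofReal (by positivity) h

end

end DeviationLearning

/-! ### Passage to measurable versions -/

theorem mainTheorem2 (Cε : ℝ) (hCε : 0 < Cε) :
    ∃ Cter : ℝ, 0 < Cter ∧
      ∀ (T : ℕ) (Ω : Type*) [MeasurableSpace Ω] (P : Measure Ω) [IsProbabilityMeasure P]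
        (θ : Ω → ℝ) (x z : ℕ → Ω → ℝ),
        HasLaw θ (ProbabilityTheory.cond volume (Set.Icc (-1 : ℝ) 1)) P →
        (∀ t < T, HasLaw (x t) (gaussianReal 0 1) P) →
        (∀ t < T, HasLaw (z t) (gaussianReal 0 1) P) →
        iIndepFun (fun i : Option (Fin T ⊕ Fin T) =>
          i.elim θ (Sum.elim (fun t => x t) (fun t => z t))) P →
        Integrable (fun ω =>
          DeviationLearning.cumRegret Cε (θ ω) (fun t => x t ω) (fun t => z t ω) T) P ∧
        ∫ ω, DeviationLearning.cumRegret Cε (θ ω) (fun t => x t ω) (fun t => z t ω) T ∂P ≤ Cter := by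
  obtain ⟨K, hK, hpot⟩ := DeviationLearning.exists_potential hCε
  refine ⟨2 * K, by positivity, fun T Ω _ P _ θ x z hθ hx hz hind => ?_⟩
  -- `HasLaw` gives only a.e. measurability. Each variable is replaced by a measurable version,
  -- which preserves laws, independence and, almost surely, the regret.
  have version : ∀ {y : ℕ → Ω → ℝ}, (∀ t < T, HasLaw (y t) (gaussianReal 0 1) P) →
      ∃ y' : ℕ → Ω → ℝ, ∀ t < T, Measurable (y' t) ∧ y t =ᵐ[P] y' t := fun {y} hy => by
    have : ∀ t, ∃ g : Ω → ℝ, t < T → Measurable g ∧ y t =ᵐ[P] g := fun t => by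
      by_cases ht : t < T
      · exact ⟨(hy t ht).aemeasurable.mk _, fun _ =>
          ⟨(hy t ht).aemeasurable.measurable_mk, (hy t ht).aemeasurable.ae_eq_mk⟩⟩
      · exact ⟨0, fun h => absurd h ht⟩
    choose g hg using this
    exact ⟨g, hg⟩
  obtain ⟨x', hx'⟩ := version hx
  obtain ⟨z', hz'⟩ := version hz
  set θ' := hθ.aemeasurable.mk θ
  have hθm : Measurable θ' := hθ.aemeasurable.measurable_mk
  have hθe : θ =ᵐ[P] θ' := hθ.aemeasurable.ae_eq_mk
  have hθ1 : ∀ᵐ ω ∂P, θ' ω ∈ Set.Icc (-1 : ℝ) 1 := by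
    have h := ae_cond_mem (μ := (volume : Measure ℝ)) (measurableSet_Icc (a := (-1 : ℝ)) (b := 1))
    rw [← hθ.map_eq] at h
    filter_upwards [ae_of_ae_map hθ.aemeasurable h, hθe] with ω h1 h2
    rwa [← h2]
  have hind' : iIndepFun (fun i : Option (Fin T ⊕ Fin T) =>
      i.elim θ' (Sum.elim (fun t => x' t) (fun t => z' t))) P := by
    refine hind.congr ?_
    rintro (_ | i | i)
    · exact hθe
    · exact (hx' i i.2).2
    · exact (hz' i i.2).2
  have main := DeviationLearning.integrable_cumRegret_and_integral_le_of_measurable hK hpot hθm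
    (fun t ht => (hx' t ht).1) (fun t ht => (hz' t ht).1) hθ1
    (fun t ht => (hx t ht).congr (hx' t ht).2.symm)
    (fun t ht => (hz t ht).congr (hz' t ht).2.symm) hind'
  have hae : (fun ω => DeviationLearning.cumRegret Cε (θ ω) (fun t => x t ω) (fun t => z t ω) T)
      =ᵐ[P] fun ω =>
        DeviationLearning.cumRegret Cε (θ' ω) (fun t => x' t ω) (fun t => z' t ω) T := by
    have h1 : ∀ᵐ ω ∂P, ∀ t, t < T → x t ω = x' t ω :=
      ae_all_iff.2 fun t => by
        by_cases ht : t < T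
        · filter_upwards [(hx' t ht).2] with ω h _ using h
        · exact ae_of_all _ fun _ h => absurd h ht
    have h2 : ∀ᵐ ω ∂P, ∀ t, t < T → z t ω = z' t ω :=
      ae_all_iff.2 fun t => by
        by_cases ht : t < T
        · filter_upwards [(hz' t ht).2] with ω h _ using h
        · exact ae_of_all _ fun _ h => absurd h ht
    filter_upwards [h1, h2, hθe] with ω k1 k2 k3
    rw [k3]
    exact DeviationLearning.cumRegret_congr _ _ k1 k2
  rw [integrable_congr hae, integral_congr_ae hae]
  exact main
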